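/- A lattice path is a finite sequence of unit steps in $\mathbb{Z}^2$, each to the right (letter $a$) or up (letter $b$); $p\cap q$ denotes the set of lattice points common to the paths $p$ and $q$, and $Y(P)$ is the second coordinate of a point $P$. For lattice points $A,B,C$ let ${}_{A}N_{B}^{C}$ be the number of triples $(p,q,p')$ of lattice paths such that $p$ goes from $A$ to $C$, $q$ goes from $B$ to $C$, $p'$ is the path starting at $B$ that spells the same word as $p$, $p\cap q=\{C\}$ and $q\cap p'=\{B\}$. Let $n,i,j$ be natural numbers with $g:=i+j-n\ge 3$ (in the application $g=|\gamma|$), and let $l_1,l_2,k$ be integers with $d:=l_1-l_2\ge 2$. Put $A_{l_1}=(l_1,n-i-l_1)$, $A_{l_2}=(l_2,n-i-l_2)$, $A_k=(k,j-k)$, and assume $Y(A_k)\ne Y(A_{l_2})$. Then the number of triples $(q_2,p_2,q_2')$ counted by ${}_{A_{l_2}}N_{A_{l_1}}^{A_k}$ is finite and $${}_{A_{l_2}}N_{A_{l_1}}^{A_k}=\sum_{r=2}^{\lfloor (g+1)/2\rfloor}\ \sum_{(n_1,\dots,n_{2r-1})\in D_r}\ \sum_{(s,t)\in C}\binom{n_1-1}{l_2-l_1+n_1+s_1}\binom{n_2}{t_2-s_1}\binom{n_{2r-1}-1}{n_{2r-1}-t_{2r-2}}\prod_{m=2}^{r-1}\binom{n_{2m-1}}{n_{2m-1}+s_{2m-1}-t_{2m-2}}\binom{n_{2m}}{t_{2m}-s_{2m-1}},$$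 where $\binom{x}{y}=0$ unless $0\le y\le x$, and: * $D_r$ is the set of tuples $(n_1,\dots,n_{2r-1})$ of positive integers with sum $g$ such that $n_1+n_3+\cdots+n_{2r-1}=k-l_2$ and $n_2+n_4+\cdots+n_{2r-2}=g-k+l_2$; * $C=C(n_1,\dots,n_{2r-1})$ is the set of all pairs $(s,t)$ of integer tuples $s=(s_1,s_3,\dots,s_{2r-3})$, $t=(t_2,t_4,\dots,t_{2r-2})$ for which the following holds, where $l,n_{2l+1}',n_{2l+1}''$ are the integers with $0\le l\le r-1$, $n_{2l+1}=n_{2l+1}'+n_{2l+1}''$, $n_{2l+1}'\ge 0$, $n_{2l+1}''>0$ and $l_1-l_2=n_{2l+1}''+n_{2l+3}+\cdots+n_{2r-1}$ (these are unique if they exist; if they do not exist, which happens exactly when $k<l_1$, then $C=\emptyset$): 1. $1\le s_1,t_2,s_3,t_4,\dots,s_{2l-1},t_{2l}\le l_1-l_2-1$; 2. $1\le s_{2l+1},t_{2l+2}\le l_1-l_2-n_{2l+1}''$, if $l\le r-2$; 3. $1\le s_{2l+\sigma},t_{2l+\sigma+1}\le l_1-l_2-n_{2l+1}''-n_{2l+3}-n_{2l+5}-\cdots-n_{2l+\sigma}$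 for every odd $\sigma$ with $3\le\sigma\le 2r-2l-3$. -/

import Mathlib

namespace AbelianBorder

/-- The two letters: `a` is a unit step to the right, `b` is a unit step up. -/
inductive Letter
  | a
  | b

/-- The displacement in `ℤ × ℤ` of one step. -/
def Letter.disp : Letter → ℤ × ℤ
  | Letter.a => (1, 0)
  | Letter.b => (0, 1)

/-- A lattice path: a starting point together with the finite sequence of its unit steps, that is,
with the binary word it spells. -/
@[ext]
structure LatticePath where
  start : ℤ × ℤ
  word : List Letter

/-- The list of lattice points visited when the word is read from a given point. -/
def pointsFrom : ℤ × ℤ → List Letter → List (ℤ × ℤ)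
  | A, [] => [A]
  | A, c :: w => A :: pointsFrom (A + c.disp) w

/-- The end point of the path that starts at a given point and spells the given word. -/
def endFrom : ℤ × ℤ → List Letter → ℤ × ℤ
  | A, [] => A
  | A, c :: w => endFrom (A + c.disp) w

/-- The set of lattice points on a path. -/
def LatticePath.points (p : LatticePath) : Set (ℤ × ℤ) := {P | P ∈ pointsFrom p.start p.word}

/-- `p` is a lattice path from `A` to `C`. -/
def LatticePath.IsFromTo (p : LatticePath) (A C : ℤ × ℤ) : Prop :=
  p.start = A ∧ endFrom p.start p.word = C

/-- The set of triples `(p, q, p')` of lattice paths such that `p` goes from `A` to `C`, `q` goes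
from `B` to `C`, `p'` is the path from `B` that spells the same word as `p`, `p` and `q` have only
`C` in common, and `q` and `p'` have only `B` in common. -/
def pathTriples (A B C : ℤ × ℤ) : Set (LatticePath × LatticePath × LatticePath) :=
  {T | T.1.IsFromTo A C ∧ T.2.1.IsFromTo B C ∧ T.2.2 = ⟨B, T.1.word⟩ ∧
    T.1.points ∩ T.2.1.points = {C} ∧ T.2.1.points ∩ T.2.2.points = {B}}

/-- The binomial coefficient `m` over `x` with an integer lower entry; it is `0` unless
`0 ≤ x ≤ m`. -/
def binom (m : ℕ) (x : ℤ) : ℕ := if 0 ≤ x then m.choose x.toNat else 0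

/-- The odd numbers in `{lo, …, hi}`. -/
def oddIdx (lo hi : ℕ) : Finset ℕ := {u ∈ Finset.Icc lo hi | Odd u}

/-- The even numbers in `{lo, …, hi}`. -/
def evenIdx (lo hi : ℕ) : Finset ℕ := {u ∈ Finset.Icc lo hi | Even u}

/-- The tuples `(n₁, …, n_{2r-1})` of positive integers (as functions of the subscript, `0` at all
other subscripts) with sum `g`, in which the odd-positioned entries sum to `x` and the
even-positioned entries sum to `g - x`. -/
noncomputable def tuples (g : ℕ) (x : ℤ) (r : ℕ) : Finset (ℕ →₀ ℕ) :=
  {n ∈ Finset.finsuppAntidiag (Finset.Icc 1 (2 * r - 1)) g |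
    (∀ u ∈ Finset.Icc 1 (2 * r - 1), 1 ≤ n u) ∧
    ∑ u ∈ oddIdx 1 (2 * r - 1), (n u : ℤ) = x ∧
    ∑ u ∈ evenIdx 1 (2 * r - 1), (n u : ℤ) = (g : ℤ) - x}

/-- `l`, `n'`, `n''` form the splitting that belongs to the tuple `n` and to `d`:
`0 ≤ l ≤ r - 1`, `n_{2l+1} = n' + n''` with `n' ≥ 0`, `n'' > 0`, and
`d = n'' + n_{2l+3} + n_{2l+5} + ⋯ + n_{2r-1}`. -/
def IsSplitting (d : ℤ) (r : ℕ) (n : ℕ →₀ ℕ) (l n' n'' : ℕ) : Prop :=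
  l + 1 ≤ r ∧ n (2 * l + 1) = n' + n'' ∧ 0 < n'' ∧
    d = (n'' : ℤ) + ∑ u ∈ oddIdx (2 * l + 3) (2 * r - 1), (n u : ℤ)

/-- The upper bound for the internal-point parameter with subscript `u`: it is `d - 1` for
`u ≤ 2l`, `d - n''` for `u = 2l+1, 2l+2`, and
`d - n'' - n_{2l+3} - n_{2l+5} - ⋯ - n_{2l+σ}` for `u = 2l+σ, 2l+σ+1` with `σ ≥ 3` odd. -/
def paramBound (d : ℤ) (n : ℕ →₀ ℕ) (l n'' u : ℕ) : ℤ :=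
  if u ≤ 2 * l then d - 1
  else d - (n'' : ℤ) - ∑ h ∈ oddIdx (2 * l + 3) u, (n h : ℤ)

open Classical in
/-- The admissible internal-point parameters `(s, t)` for a tuple `n`: `s` carries the odd
subscripts `1, 3, …, 2r-3`, `t` the even subscripts `2, 4, …, 2r-2` (both are `0` at all other
subscripts), and every entry lies between `1` and its upper bound. All the upper bounds are at most
`d - 1`, so that nothing is lost by choosing the entries from `{1, …, d - 1}` to begin with. -/
noncomputable def params (d : ℤ) (r : ℕ) (n : ℕ →₀ ℕ) : Finset ((ℕ →₀ ℤ) × (ℕ →₀ ℤ)) :=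
  {st ∈ (oddIdx 1 (2 * r - 2)).finsupp (fun _ => Finset.Icc (1 : ℤ) (d - 1)) ×ˢ
      (evenIdx 1 (2 * r - 2)).finsupp (fun _ => Finset.Icc (1 : ℤ) (d - 1)) |
    ∃ l n' n'' : ℕ, IsSplitting d r n l n' n'' ∧
      (∀ u ∈ oddIdx 1 (2 * r - 2), st.1 u ≤ paramBound d n l n'' u) ∧
      (∀ u ∈ evenIdx 1 (2 * r - 2), st.2 u ≤ paramBound d n l n'' u)}

/-- The product of binomial coefficients attached to `r`, the tuple `n` and the parameters
`s`, `t`. -/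
def summand (d : ℤ) (r : ℕ) (n : ℕ →₀ ℕ) (s t : ℕ →₀ ℤ) : ℕ :=
  binom (n 1 - 1) (-d + n 1 + s 1) * binom (n 2) (t 2 - s 1) *
    binom (n (2 * r - 1) - 1) (n (2 * r - 1) - t (2 * r - 2)) *
    ∏ m ∈ Finset.Icc 2 (r - 1),
      (binom (n (2 * m - 1)) (n (2 * m - 1) + s (2 * m - 1) - t (2 * m - 2)) *
        binom (n (2 * m)) (t (2 * m) - s (2 * m - 1)))

end AbelianBorder

namespace AbelianBorder

/-- The horizontal displacement of a word. -/
def xDisp (w : List Letter) : ℤ := (w.map fun c => c.disp.1).sum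

lemma endFrom_eq (w : List Letter) (A : ℤ × ℤ) :
    endFrom A w = (A.1 + xDisp w, A.2 + (w.length - xDisp w)) := by
  induction w generalizing A with
  | nil => simp [endFrom, xDisp]
  | cons c w ih =>
    rw [endFrom, ih]
    cases c <;> ext <;> simp [Letter.disp, xDisp] <;> ring

lemma mem_pointsFrom (w : List Letter) (A P : ℤ × ℤ) :
    P ∈ pointsFrom A w ↔ ∃ m ≤ w.length, P = endFrom A (w.take m) := by
  induction w generalizing A with
  | nil => simp [pointsFrom, endFrom]
  | cons c w ih =>
    rw [pointsFrom, List.mem_cons, ih]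
    constructor
    · rintro (rfl | ⟨m, hm, rfl⟩)
      · exact ⟨0, by simp, by simp [endFrom]⟩
      · exact ⟨m + 1, by simpa using hm, by simp [endFrom]⟩
    · rintro ⟨m, hm, rfl⟩
      cases m with
      | zero => left; simp [endFrom]
      | succ m => right; exact ⟨m, by simpa using hm, by simp [endFrom]⟩

/-! ### Pairs of words, their height, and the translation of path triples -/

/-- Two words of equal length read in parallel, letter by letter: the first component says whether
the letter of the first word is `a`, the second whether the two letters differ. -/
abbrev PairWord := List (Bool × Bool)

/-- The letter of the first word. -/
def fstLetter (x : Bool × Bool) : Letter := if x.1 then Letter.a else Letter.b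

/-- The letter of the second word. -/
def sndLetter (x : Bool × Bool) : Letter := if x.1 != x.2 then Letter.a else Letter.b

/-- The contribution of one pair of letters to the height. -/
def weight (x : Bool × Bool) : ℤ := if x.2 then (if x.1 then 1 else -1) else 0

/-- The number of `a`s in the first word minus the number of `a`s in the second one. -/
def height (L : PairWord) : ℤ := (L.map weight).sum

/-- The number of `a`s in the first word. -/
def countA (L : PairWord) : ℤ := xDisp (L.map fstLetter)

@[simp] lemma height_nil : height [] = 0 := rfl

@[simp] lemma height_append (L M : PairWord) : height (L ++ M) = height L + height M := by
  simp [height]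

@[simp] lemma height_singleton (x : Bool × Bool) : height [x] = weight x := by
  simp [height]

@[simp] lemma countA_nil : countA [] = 0 := rfl

@[simp] lemma countA_append (L M : PairWord) : countA (L ++ M) = countA L + countA M := by
  simp [countA, xDisp]

lemma xDisp_sndLetter (L : PairWord) : xDisp (L.map sndLetter) = countA L - height L := by
  induction L with
  | nil => simp [countA, xDisp, height]
  | cons x L ih =>
    obtain ⟨x, y⟩ := x
    simp only [countA, xDisp, height, List.map_cons, List.sum_cons] at ih ⊢
    rw [ih]
    cases x <;> cases y <;> simp [fstLetter, sndLetter, weight, Letter.disp] <;> ring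

lemma exists_pairWord (w v : List Letter) (h : w.length = v.length) :
    ∃ L : PairWord, L.map fstLetter = w ∧ L.map sndLetter = v := by
  induction w generalizing v with
  | nil => exact ⟨[], by simp, by simpa using (List.length_eq_zero_iff.1 h.symm).symm⟩
  | cons c w ih =>
    cases v with
    | nil => simp at h
    | cons e v =>
      obtain ⟨L, rfl, rfl⟩ := ih v (by simpa using h)
      have : ∃ x : Bool × Bool, fstLetter x = c ∧ sndLetter x = e := by
        cases c <;> cases e
        · exact ⟨(true, false), rfl, rfl⟩
        · exact ⟨(true, true), rfl, rfl⟩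
        · exact ⟨(false, true), rfl, rfl⟩
        · exact ⟨(false, false), rfl, rfl⟩
      obtain ⟨x, rfl, rfl⟩ := this
      exact ⟨x :: L, by simp, by simp⟩

lemma letters_injective (L M : PairWord) (h₁ : L.map fstLetter = M.map fstLetter)
    (h₂ : L.map sndLetter = M.map sndLetter) : L = M := by
  induction L generalizing M with
  | nil => simpa using h₁
  | cons x L ih =>
    cases M with
    | nil => simp at h₁
    | cons y M =>
      simp only [List.map_cons, List.cons.injEq] at h₁ h₂
      rw [ih M h₁.2 h₂.2]
      obtain ⟨a, b⟩ := x
      obtain ⟨a', b'⟩ := y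
      have h3 := h₁.1
      have h4 := h₂.1
      clear ih h₁ h₂
      revert h3 h4
      cases a <;> cases b <;> cases a' <;> cases b' <;> simp [fstLetter, sndLetter]

/-- Pairs of words of length `g` whose height stays strictly between `0` and `d` until it reaches
`d` at the end, the first word containing `x` letters `a`. -/
def Admissible (d x : ℤ) (g : ℕ) (L : PairWord) : Prop :=
  L.length = g ∧ countA L = x ∧ height L = d ∧
    ∀ m, 0 < m → m < g → 0 < height (L.take m) ∧ height (L.take m) < d

lemma height_take_succ (L : PairWord) (m : ℕ) :
    height (L.take m) - 1 ≤ height (L.take (m + 1)) ∧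
      height (L.take (m + 1)) ≤ height (L.take m) + 1 := by
  rw [List.take_add_one]
  cases L[m]? with
  | none => simp
  | some x =>
    obtain ⟨x, y⟩ := x
    cases x <;> cases y <;> (simp [weight]; try omega)

/-- A discrete intermediate value argument: with steps of size at most 1, avoiding `0` and `d` at
the relevant times is the same as staying strictly between them. -/
lemma admissible_iff {d x : ℤ} (hd : 0 < d) (g : ℕ) (L : PairWord) :
    Admissible d x g L ↔ L.length = g ∧ countA L = x ∧ height L = d ∧
      (∀ m < g, height (L.take m) ≠ d) ∧ (∀ m ≤ g, 0 < m → height (L.take m) ≠ 0) := by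
  refine and_congr_right fun hg => and_congr_right fun _ => and_congr_right fun hL => ?_
  have hfull : height (L.take g) = d := by rw [← hg, List.take_length, hL]
  constructor
  · intro h
    refine ⟨fun m hm => ?_, fun m hm h0 => ?_⟩
    · rcases Nat.eq_zero_or_pos m with rfl | h0
      · simpa using hd.ne
      · exact (h m h0 hm).2.ne
    · rcases hm.lt_or_eq with hm | rfl
      · exact (h m h0 hm).1.ne'
      · omega
  · rintro ⟨h1, h2⟩ m h0 hm
    constructor
    -- Positivity propagates backwards from the final value `d`; the bound by `d` below propagates
    -- forwards from the initial value `0`.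
    · have key : ∀ k < g, 0 < height (L.take (g - k)) := by
        intro k
        induction k with
        | zero => intro _; simpa [hfull] using hd
        | succ k ih =>
          intro hk
          have e : g - k = g - (k + 1) + 1 := by omega
          have a1 := ih (by omega)
          rw [e] at a1
          have a2 := height_take_succ L (g - (k + 1))
          have a3 := h2 (g - (k + 1)) (by omega) (by omega)
          omega
      have := key (g - m) (by omega)
      rwa [show g - (g - m) = m by omega] at this
    · have key : ∀ k < g, height (L.take k) < d := by
        intro k
        induction k with
        | zero => intro _; simpa using hd
        | succ k ih =>
          intro hk
          have a1 := ih (by omega)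
          have a2 := height_take_succ L k
          have a3 := h1 (k + 1) hk
          omega
      exact key m hm

lemma pathTriples_eq_image {d x : ℤ} (hd : 0 < d) (g : ℕ) (A : ℤ × ℤ) :
    pathTriples A (A.1 + d, A.2 - d) (A.1 + x, A.2 + (g - x)) =
      (fun L : PairWord => ((⟨A, L.map fstLetter⟩, ⟨(A.1 + d, A.2 - d), L.map sndLetter⟩,
        ⟨(A.1 + d, A.2 - d), L.map fstLetter⟩) : LatticePath × LatticePath × LatticePath)) ''
        {L | Admissible d x g L} := by
  have main : ∀ L : PairWord,
      ((⟨A, L.map fstLetter⟩, ⟨(A.1 + d, A.2 - d), L.map sndLetter⟩,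
        ⟨(A.1 + d, A.2 - d), L.map fstLetter⟩) : LatticePath × LatticePath × LatticePath) ∈
        pathTriples A (A.1 + d, A.2 - d) (A.1 + x, A.2 + (g - x)) ↔ Admissible d x g L := by
    intro L
    have hc : ∀ m, xDisp ((L.map fstLetter).take m) = countA (L.take m) := by
      intro m; rw [← List.map_take]; rfl
    have hs : ∀ m, xDisp ((L.map sndLetter).take m) =
        countA (L.take m) - height (L.take m) := by
      intro m; rw [← List.map_take, xDisp_sndLetter]
    rw [admissible_iff hd]
    simp only [pathTriples, Set.mem_ofPred_eq, LatticePath.IsFromTo, LatticePath.points,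
      true_and, endFrom_eq, mem_pointsFrom, Set.ext_iff, Set.mem_inter_iff,
      Set.mem_singleton_iff, Prod.mk.injEq, xDisp_sndLetter, List.length_map, hc, hs,
      List.length_take, show xDisp (L.map fstLetter) = countA L from rfl]
    constructor
    · rintro ⟨⟨h1, h2⟩, ⟨h3, h4⟩, h5, h6⟩
      have hg : L.length = g := by omega
      refine ⟨hg, by omega, by omega, fun m hm he => ?_, fun m hm h0 he => ?_⟩
      -- If the height is `d` at time `m`, both paths are at this point, which must then be the end
      -- point; the coordinate sum forces `m = g`.
      · have := ((h5 (A.1 + countA (L.take m), A.2 + (m - countA (L.take m)))).1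
          ⟨⟨m, by omega, by simp; omega⟩, ⟨m, by omega, by simp; omega⟩⟩)
        simp only [Prod.mk.injEq] at this
        omega
      · have := ((h6 (A.1 + d + countA (L.take m), A.2 - d + (m - countA (L.take m)))).1
          ⟨⟨m, by omega, by simp; omega⟩, ⟨m, by omega, by simp; omega⟩⟩)
        simp only [Prod.mk.injEq] at this
        omega
    · rintro ⟨hg, h1, h2, h3, h4⟩
      subst hg
      refine ⟨⟨by omega, by omega⟩, ⟨by omega, by omega⟩, ?_, ?_⟩
      · rintro ⟨P, Q⟩
        simp only [Prod.mk.injEq]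
        constructor
        · rintro ⟨⟨m, hm, e1, e2⟩, ⟨k, hk, e3, e4⟩⟩
          -- The coordinate sum of a point is that of the starting point plus the time, and both
          -- starting points have the same sum.
          have hmk : m = k := by omega
          subst hmk
          rcases hm.lt_or_eq with hm | rfl
          · exact absurd (by omega) (h3 m hm)
          · rw [List.take_length] at e1 e2
            omega
        · rintro ⟨rfl, rfl⟩
          exact ⟨⟨L.length, le_rfl, by simp; omega⟩, ⟨L.length, le_rfl, by simp; omega⟩⟩
      · rintro ⟨P, Q⟩
        simp only [Prod.mk.injEq]
        constructor
        · rintro ⟨⟨m, hm, e1, e2⟩, ⟨k, hk, e3, e4⟩⟩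
          have hmk : m = k := by omega
          subst hmk
          rcases Nat.eq_zero_or_pos m with rfl | h0
          · simp at e1 e2
            omega
          · exact absurd (by omega) (h4 m hm h0)
        · rintro ⟨rfl, rfl⟩
          exact ⟨⟨0, by omega, by simp⟩, ⟨0, by omega, by simp⟩⟩
  ext ⟨⟨S, w⟩, ⟨S', v⟩, p'⟩
  simp only [Set.mem_image, Set.mem_ofPred_eq]
  constructor
  · intro h
    obtain ⟨⟨h1, h2⟩, ⟨h3, h4⟩, h5, -⟩ := id h
    change S = A at h1
    change S' = (A.1 + d, A.2 - d) at h3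
    change p' = ⟨(A.1 + d, A.2 - d), w⟩ at h5
    subst h1 h3 h5
    simp only [endFrom_eq, Prod.mk.injEq] at h2 h4
    obtain ⟨L, rfl, rfl⟩ := exists_pairWord w v (by omega)
    exact ⟨L, (main L).1 h, rfl⟩
  · rintro ⟨L, hL, he⟩
    rw [← he]
    exact (main L).2 hL

lemma ncard_pathTriples {d x : ℤ} (hd : 0 < d) (g : ℕ) (A : ℤ × ℤ) :
    (pathTriples A (A.1 + d, A.2 - d) (A.1 + x, A.2 + (g - x))).ncard =
      {L | Admissible d x g L}.ncard := by
  rw [pathTriples_eq_image hd]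
  refine Set.ncard_image_of_injective _ fun L M h => ?_
  simp only [Prod.mk.injEq, LatticePath.mk.injEq, true_and] at h
  exact letters_injective L M h.1 h.2.1


/-! ### Counting Boolean lists with a prescribed number of `true` -/

/-- All Boolean lists of a given length. -/
def boolLists : ℕ → Finset (List Bool)
  | 0 => {[]}
  | n + 1 => (boolLists n).image (List.cons true) ∪ (boolLists n).image (List.cons false)

lemma mem_boolLists {n : ℕ} {l : List Bool} : l ∈ boolLists n ↔ l.length = n := by
  induction n generalizing l with
  | zero => simp [boolLists]
  | succ n ih =>
    cases l with
    | nil => simp [boolLists]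
    | cons x l => cases x <;> simp [boolLists, ih]

lemma binom_zero_left (c : ℤ) : binom 0 c = if c = 0 then 1 else 0 := by
  unfold binom
  rcases lt_trichotomy c 0 with h | rfl | h
  · simp [h.not_ge, h.ne]
  · simp
  · rw [if_pos h.le, if_neg h.ne', Nat.choose_eq_zero_of_lt (by omega)]

lemma binom_succ (n : ℕ) (c : ℤ) : binom (n + 1) c = binom n (c - 1) + binom n c := by
  unfold binom
  rcases lt_trichotomy c 0 with h | rfl | h
  · simp [h.not_ge, show ¬ 1 ≤ c by omega]
  · simp
  · rw [if_pos h.le, if_pos h.le, if_pos (by omega),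
      show c.toNat = (c - 1).toNat + 1 by omega, Nat.choose_succ_succ]

lemma binom_symm (n : ℕ) (c : ℤ) : binom n (n - c) = binom n c := by
  unfold binom
  by_cases h : 0 ≤ c
  · by_cases h' : c ≤ n
    · rw [if_pos h, if_pos (by omega), ← Nat.choose_symm (by omega : c.toNat ≤ n)]
      congr 1
      omega
    · rw [if_pos h, if_neg (by omega), Nat.choose_eq_zero_of_lt (by omega)]
  · rw [if_neg h]
    split_ifs
    · exact Nat.choose_eq_zero_of_lt (by omega)
    · rfl

lemma card_filter_boolLists_succ (n : ℕ) (p : List Bool → Prop) [DecidablePred p] :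
    ((boolLists (n + 1)).filter p).card = ((boolLists n).filter fun l => p (true :: l)).card +
      ((boolLists n).filter fun l => p (false :: l)).card := by
  rw [boolLists, Finset.filter_union, Finset.card_union_of_disjoint, Finset.filter_image,
    Finset.filter_image, Finset.card_image_of_injective _ (List.cons_injective),
    Finset.card_image_of_injective _ (List.cons_injective)]
  rw [Finset.disjoint_left]
  intro l h1 h2
  simp only [Finset.mem_filter, Finset.mem_image] at h1 h2
  obtain ⟨⟨a, -, rfl⟩, -⟩ := h1
  obtain ⟨⟨b, -, h⟩, -⟩ := h2
  simp at h

lemma card_boolLists_count (n : ℕ) (c : ℤ) :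
    ((boolLists n).filter fun l => (l.count true : ℤ) = c).card = binom n c := by
  induction n generalizing c with
  | zero =>
    rw [binom_zero_left, boolLists, Finset.filter_singleton]
    rcases eq_or_ne c 0 with rfl | h
    · simp
    · simp [h, h.symm]
  | succ n ih =>
    rw [card_filter_boolLists_succ, binom_succ, ← ih, ← ih]
    congr 2
    ext l
    simp [eq_sub_iff_add_eq]

/-- Deleting the forced head leaves `n - 1` places with `c - 1` times `true`; symmetry of the
binomial coefficient turns `c - 1` into `n - c`, the form used in `summand`. -/
lemma card_boolLists_head {n : ℕ} (hn : 1 ≤ n) (c : ℤ) :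
    ((boolLists n).filter fun l => (l.count true : ℤ) = c ∧ l.head? = some true).card =
      binom (n - 1) (n - c) := by
  obtain ⟨n, rfl⟩ := Nat.exists_eq_add_of_le' hn
  rw [card_filter_boolLists_succ, Nat.add_sub_cancel,
    show ((n + 1 : ℕ) : ℤ) - c = n - (c - 1) by push_cast; ring, binom_symm,
    ← card_boolLists_count]
  simp [eq_sub_iff_add_eq]

lemma card_boolLists_getLast {n : ℕ} (hn : 1 ≤ n) (c : ℤ) :
    ((boolLists n).filter fun l => (l.count true : ℤ) = c ∧ l.getLast? = some true).card =
      binom (n - 1) (n - c) := by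
  rw [← card_boolLists_head hn]
  refine Finset.card_bij (fun l _ => l.reverse) ?_ ?_ ?_
  · intro l hl
    simpa [mem_boolLists] using hl
  · intro l _ l' _ h
    exact List.reverse_injective h
  · intro l hl
    exact ⟨l.reverse, by simpa [mem_boolLists] using hl, by simp⟩

/-! ### Decomposition into alternating blocks -/

/-- The pairs of words of which the first one is a power of a letter, namely of `a` if `u` is even
and of `b` if `u` is odd, while `l` says where the second word differs from it. -/
def block (u : ℕ) (l : List Bool) : PairWord := l.map (Prod.mk (decide (Even u)))

/-- The concatenation of `m` alternating blocks. -/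
def build (F : ℕ → List Bool) : ℕ → PairWord
  | 0 => []
  | u + 1 => build F u ++ block u (F u)

@[simp] lemma length_block (u : ℕ) (l : List Bool) : (block u l).length = l.length := by
  simp [block]

lemma block_take (u j : ℕ) (l : List Bool) : block u (l.take j) = (block u l).take j := by
  simp [block, List.map_take]

lemma block_injective (u : ℕ) : Function.Injective (block u) :=
  List.map_injective_iff.2 (Prod.mk_right_injective _)

lemma height_block (u : ℕ) (l : List Bool) :
    height (block u l) = if Even u then (l.count true : ℤ) else -l.count true := by
  induction l with
  | nil => simp [block]
  | cons x l ih =>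
    have : block u (x :: l) = [(decide (Even u), x)] ++ block u l := rfl
    rw [this, height_append, ih, height_singleton]
    by_cases h : Even u <;> cases x <;> (simp [weight, h]; try ring)

lemma countA_block (u : ℕ) (l : List Bool) :
    countA (block u l) = if Even u then (l.length : ℤ) else 0 := by
  induction l with
  | nil => simp [block]
  | cons x l ih =>
    have : block u (x :: l) = [(decide (Even u), x)] ++ block u l := rfl
    rw [this, countA_append, ih]
    by_cases h : Even u <;> simp [countA, fstLetter, xDisp, Letter.disp, h]
    ring

lemma build_congr {F G : ℕ → List Bool} {m : ℕ} (h : ∀ u < m, F u = G u) :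
    build F m = build G m := by
  induction m with
  | zero => rfl
  | succ m ih => rw [build, build, ih fun u hu => h u (by omega), h m (by omega)]

lemma length_build (F : ℕ → List Bool) (m : ℕ) :
    (build F m).length = ∑ u ∈ Finset.range m, (F u).length := by
  induction m with
  | zero => rfl
  | succ m ih => rw [build, List.length_append, ih, length_block, Finset.sum_range_succ]

lemma countA_build (F : ℕ → List Bool) (m : ℕ) :
    countA (build F m) = ∑ u ∈ Finset.range m, if Even u then ((F u).length : ℤ) else 0 := by
  induction m with
  | zero => rfl
  | succ m ih => rw [build, countA_append, ih, countA_block, Finset.sum_range_succ]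

lemma height_build_succ (F : ℕ → List Bool) (m : ℕ) :
    height (build F (m + 1)) = height (build F m) +
      if Even m then ((F m).count true : ℤ) else -(F m).count true := by
  rw [build, height_append, height_block]

lemma build_eq_flatten (F : ℕ → List Bool) (m : ℕ) :
    build F m = ((List.range m).map fun u => block u (F u)).flatten := by
  induction m with
  | zero => rfl
  | succ m ih => simp [build, ih, List.range_succ]

/-- Nonempty alternating blocks are exactly the maximal runs of the first component, so the
decomposition is recovered from the concatenation. -/
lemma splitBy_build (F : ℕ → List Bool) (m : ℕ) (h : ∀ u < m, F u ≠ []) :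
    (build F m).splitBy (fun x y => x.1 == y.1) =
      (List.range m).map fun u => block u (F u) := by
  rw [build_eq_flatten]
  apply List.splitBy_flatten
  · simpa [block] using h
  · simp only [List.mem_map, List.mem_range]
    rintro _ ⟨u, -, rfl⟩
    refine (List.pairwise_of_forall_mem_list ?_).isChain
    simp only [block, List.mem_map]
    rintro _ ⟨a, -, rfl⟩ _ ⟨b, -, rfl⟩
    simp
  · rw [List.isChain_map, List.isChain_range]
    intro u hu
    refine ⟨by simpa [block] using h u (by omega), by simpa [block] using h (u + 1) (by omega), ?_⟩
    by_cases hu : Even u <;> simp [block, hu, Nat.even_add_one]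

lemma build_inj {F G : ℕ → List Bool} {m k : ℕ} (hF : ∀ u < m, F u ≠ [])
    (hG : ∀ u < k, G u ≠ []) (h : build F m = build G k) : m = k ∧ ∀ u < m, F u = G u := by
  have h1 := splitBy_build F m hF
  rw [h, splitBy_build G k hG] at h1
  have h2 := congrArg List.length h1
  simp only [List.length_map, List.length_range] at h2
  subst h2
  refine ⟨rfl, fun u hu => ?_⟩
  have h3 : ∀ u < k, block u (G u) = block u (F u) := by
    simpa using h1
  exact (block_injective u (h3 u hu)).symm

/-- Append one pair of letters at a time: it prolongs the last block if its first letter has the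
parity of that block, and opens a new block otherwise. -/
lemma exists_build (L : PairWord) (hL : L.head?.map Prod.fst = some true) :
    ∃ (m : ℕ) (F : ℕ → List Bool), (∀ u < m + 1, F u ≠ []) ∧ build F (m + 1) = L := by
  induction L using List.reverseRecOn with
  | nil => simp at hL
  | append_singleton L x ih =>
    obtain ⟨x, y⟩ := x
    rcases eq_or_ne L [] with rfl | hne
    · obtain rfl : x = true := by simpa using hL
      exact ⟨0, fun _ => [y], by simp, by simp [build, block]⟩
    · obtain ⟨m, F, hF, rfl⟩ := ih (by rwa [List.head?_append_of_ne_nil _ hne] at hL)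
      by_cases hx : x = decide (Even m)
      · refine ⟨m, Function.update F m (F m ++ [y]), fun u hu => ?_, ?_⟩
        · rcases eq_or_ne u m with rfl | h
          · simp
          · simpa [h] using hF u hu
        · rw [build, build, build_congr (G := F)
            fun u hu => Function.update_of_ne (by omega) _ _]
          simp [block, hx]
      · refine ⟨m + 1, Function.update F (m + 1) [y], fun u hu => ?_, ?_⟩
        · rcases eq_or_ne u (m + 1) with rfl | h
          · simp
          · simpa [h] using hF u (by omega)
        · rw [build, build_congr (G := F) fun u hu => Function.update_of_ne (by omega) _ _]
          have : x = decide (Even (m + 1)) := by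
            by_cases hm : Even m <;> simp_all [Nat.even_add_one]
          simp [block, this]

lemma exists_take_build (F : ℕ → List Bool) {m k : ℕ} (hk : k < (build F m).length) :
    ∃ u < m, ∃ j < (F u).length, k = (build F u).length + j ∧
      (build F m).take k = build F u ++ block u ((F u).take j) := by
  induction m with
  | zero => simp [build] at hk
  | succ m ih =>
    by_cases h : k < (build F m).length
    · obtain ⟨u, hu, j, hj, h1, h2⟩ := ih h
      refine ⟨u, by omega, j, hj, h1, ?_⟩
      rw [← h2, build, List.take_append_of_le_length h.le]
    · rw [build, List.length_append, length_block] at hk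
      refine ⟨m, by omega, k - (build F m).length, by omega, by omega, ?_⟩
      rw [build, List.take_append, List.take_of_length_le (by omega), block_take]

/-- The concatenations of `m` alternating blocks that are taken from given sets. -/
def concatenations (B : ℕ → Finset (List Bool)) : ℕ → Finset PairWord
  | 0 => {[]}
  | m + 1 => Finset.image₂ (fun L l => L ++ block m l) (concatenations B m) (B m)

lemma mem_concatenations {B : ℕ → Finset (List Bool)} {m : ℕ} {L : PairWord} :
    L ∈ concatenations B m ↔ ∃ F : ℕ → List Bool, (∀ u < m, F u ∈ B u) ∧ build F m = L := by
  induction m generalizing L with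
  | zero => simp [concatenations, build, eq_comm]
  | succ m ih =>
    simp only [concatenations, Finset.mem_image₂, ih]
    constructor
    · rintro ⟨_, ⟨F, hF, rfl⟩, l, hl, rfl⟩
      refine ⟨Function.update F m l, fun u hu => ?_, ?_⟩
      · rcases eq_or_ne u m with rfl | h
        · simpa
        · simpa [h] using hF u (by omega)
      · rw [build, build_congr (G := F) fun u hu => Function.update_of_ne (by omega) _ _]
        simp
    · rintro ⟨F, hF, rfl⟩
      exact ⟨_, ⟨F, fun u hu => hF u (by omega), rfl⟩, F m, hF m (by omega), rfl⟩

/-- Prescribed block lengths make concatenation injective. -/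
lemma card_concatenations (B : ℕ → Finset (List Bool)) (N : ℕ → ℕ) (m : ℕ)
    (h : ∀ u < m, ∀ l ∈ B u, l.length = N u) :
    (concatenations B m).card = ∏ u ∈ Finset.range m, (B u).card := by
  induction m with
  | zero => rfl
  | succ m ih =>
    rw [Finset.prod_range_succ, ← ih fun u hu => h u (by omega), concatenations,
      Finset.card_image₂_iff]
    rintro ⟨L, l⟩ h1 ⟨L', l'⟩ h2 he
    simp only [Set.mem_prod, Finset.mem_coe] at h1 h2
    have := List.append_inj' he (by simp [h m (by omega) l h1.2, h m (by omega) l' h2.2])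
    exact Prod.ext this.1 (block_injective m this.2)


/-! ### Deficits, and the product of binomials as a count of blocks -/

lemma mem_oddIdx {lo hi u : ℕ} : u ∈ oddIdx lo hi ↔ (lo ≤ u ∧ u ≤ hi) ∧ Odd u := by
  simp [oddIdx]

lemma mem_evenIdx {lo hi u : ℕ} : u ∈ evenIdx lo hi ↔ (lo ≤ u ∧ u ≤ hi) ∧ Even u := by
  simp [evenIdx]

lemma prod_range_odd_length {M : Type*} [CommMonoid M] (f : ℕ → M) {r : ℕ} (hr : 2 ≤ r) :
    ∏ u ∈ Finset.range (2 * r - 1), f u =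
      f 0 * f 1 * f (2 * r - 2) *
        ∏ m ∈ Finset.Icc 2 (r - 1), (f (2 * m - 2) * f (2 * m - 1)) := by
  induction r, hr using Nat.le_induction with
  | base => simp [Finset.prod_range_succ]
  | succ r hr ih =>
    rw [show 2 * (r + 1) - 1 = 2 * r - 1 + 1 + 1 by omega, Finset.prod_range_succ,
      Finset.prod_range_succ, ih, show r + 1 - 1 = r - 1 + 1 by omega,
      Finset.prod_Icc_succ_top (by omega), show 2 * (r - 1 + 1) - 2 = 2 * r - 2 by omega,
      show 2 * (r - 1 + 1) - 1 = 2 * r - 1 by omega, show 2 * (r + 1) - 2 = 2 * r by omega,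
      show 2 * r - 1 + 1 = 2 * r by omega]
    ac_rfl

/-- The amount by which the height after the first `u` blocks falls short of `d`, in terms of the
parameters. -/
def deficit (d : ℤ) (s t : ℕ →₀ ℤ) (u : ℕ) : ℤ := if u = 0 then d else s u + t u

/-- The number of places where the two words differ in the block number `u`. -/
def differences (d : ℤ) (s t : ℕ →₀ ℤ) (u : ℕ) : ℤ :=
  if Even u then deficit d s t u - deficit d s t (u + 1)
  else deficit d s t (u + 1) - deficit d s t u

/-- The possible blocks number `u` of the admissible pairs of words with given parameters. -/
def blockSet (d : ℤ) (r : ℕ) (n : ℕ →₀ ℕ) (s t : ℕ →₀ ℤ) (u : ℕ) : Finset (List Bool) :=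
  (boolLists (n (u + 1))).filter fun l =>
    (l.count true : ℤ) = differences d s t u ∧
      (u = 0 → l.head? = some true) ∧ (u + 1 = 2 * r - 1 → l.getLast? = some true)

lemma mem_blockSet {d : ℤ} {r : ℕ} {n : ℕ →₀ ℕ} {s t : ℕ →₀ ℤ} {u : ℕ} {l : List Bool} :
    l ∈ blockSet d r n s t u ↔ l.length = n (u + 1) ∧ (l.count true : ℤ) = differences d s t u ∧
      (u = 0 → l.head? = some true) ∧ (u + 1 = 2 * r - 1 → l.getLast? = some true) := by
  rw [blockSet, Finset.mem_filter, mem_boolLists]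

/-- Blocks are numbered from `0`, so block `u` has length `n (u + 1)`. Interior blocks give full
binomials; the first and the last have one forced `true`, whence the `- 1` in their upper entries.
-/
lemma prod_card_blockSet (d : ℤ) {r : ℕ} (hr : 2 ≤ r) (n : ℕ →₀ ℕ) (s t : ℕ →₀ ℤ)
    (hn : ∀ u ∈ Finset.Icc 1 (2 * r - 1), 1 ≤ n u)
    (hs : s.support ⊆ oddIdx 1 (2 * r - 2)) (ht : t.support ⊆ evenIdx 1 (2 * r - 2)) :
    ∏ u ∈ Finset.range (2 * r - 1), (blockSet d r n s t u).card = summand d r n s t := by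
  have hs0 : ∀ u, u ∉ oddIdx 1 (2 * r - 2) → s u = 0 := fun u hu =>
    Finsupp.notMem_support_iff.1 fun h => hu (hs h)
  have ht0 : ∀ u, u ∉ evenIdx 1 (2 * r - 2) → t u = 0 := fun u hu =>
    Finsupp.notMem_support_iff.1 fun h => hu (ht h)
  simp only [mem_oddIdx, mem_evenIdx] at hs0 ht0
  have hodd : ∀ u, Odd u → deficit d s t u = s u := by
    intro u hu
    rw [deficit, if_neg (by rintro rfl; simp at hu), ht0, add_zero]
    exact fun h => Nat.not_even_iff_odd.2 hu h.2
  have heven : ∀ u, 0 < u → Even u → deficit d s t u = t u := by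
    intro u h0 hu
    rw [deficit, if_neg h0.ne', hs0, zero_add]
    exact fun h => Nat.not_even_iff_odd.2 h.2 hu
  have hmid : ∀ u, u ≠ 0 → u + 1 ≠ 2 * r - 1 →
      (blockSet d r n s t u).card = binom (n (u + 1)) (differences d s t u) := by
    intro u h1 h2
    rw [← card_boolLists_count, blockSet]
    simp [h1, h2]
  rw [prod_range_odd_length _ hr, summand]
  congr 1
  · congr 1
    · congr 1
      · have : blockSet d r n s t 0 = (boolLists (n 1)).filter fun l =>
            (l.count true : ℤ) = d - s 1 ∧ l.head? = some true := by
          ext l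
          simp only [mem_blockSet, Finset.mem_filter, mem_boolLists, differences, zero_add,
            Even.zero, if_true, hodd 1 odd_one, forall_true_left,
            show 1 ≠ 2 * r - 1 by omega, false_imp_iff, and_true]
          simp [deficit]
        rw [this, card_boolLists_head (hn 1 (by simp; omega))]
        congr 1
        ring
      · rw [hmid 1 (by omega) (by omega), differences, if_neg (by decide), hodd 1 odd_one,
          heven 2 (by omega) even_two]
    · have e : 2 * r - 2 + 1 = 2 * r - 1 := by omega
      have hev : Even (2 * r - 2) := ⟨r - 1, by omega⟩
      have : blockSet d r n s t (2 * r - 2) = (boolLists (n (2 * r - 1))).filter fun l =>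
          (l.count true : ℤ) = t (2 * r - 2) ∧ l.getLast? = some true := by
        ext l
        simp only [mem_blockSet, Finset.mem_filter, mem_boolLists, differences, e, hev, if_true,
          show 2 * r - 2 ≠ 0 by omega, false_imp_iff, true_and, forall_true_left,
          heven _ (by omega) hev]
        -- The subscript `2r-1` lies outside the support of `s`: the final deficit is `0`.
        rw [hodd (2 * r - 1) ⟨r - 1, by omega⟩, hs0 (2 * r - 1) (by omega), sub_zero]
      rw [this, card_boolLists_getLast (hn _ (by simp; omega))]
  · refine Finset.prod_congr rfl fun m hm => ?_
    rw [Finset.mem_Icc] at hm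
    have e1 : 2 * m - 2 + 1 = 2 * m - 1 := by omega
    have e2 : 2 * m - 1 + 1 = 2 * m := by omega
    have o1 : Odd (2 * m - 1) := ⟨m - 1, by omega⟩
    have o2 : Even (2 * m - 2) := ⟨m - 1, by omega⟩
    rw [hmid _ (by omega) (by omega), hmid _ (by omega) (by omega), differences, differences,
      if_pos o2, if_neg (Nat.not_even_iff_odd.2 o1), e1, e2, hodd _ o1,
      heven (2 * m - 2) (by omega) o2, heven (2 * m) (by omega) (even_two_mul m), ← binom_symm]
    congr 2
    ring

/-! ### The upper bounds for the parameters -/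

/-- Backwards from `h N = 0`: only steps from an even index can lower `h`, each by at most the next
entry of `n`. -/
lemma le_sum_oddIdx {N : ℕ} {h : ℕ → ℤ} {n : ℕ →₀ ℕ} (hN : h N = 0)
    (he : ∀ u < N, Even u → h u ≤ h (u + 1) + n (u + 1))
    (ho : ∀ u < N, Odd u → h u ≤ h (u + 1)) {u : ℕ} (hu : u ≤ N) :
    h u ≤ ∑ v ∈ oddIdx (u + 1) N, (n v : ℤ) := by
  induction hu using Nat.decreasingInduction with
  | self => rw [hN]; positivity
  | of_succ u hu ih =>
    rcases Nat.even_or_odd u with hp | hp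
    · have : oddIdx (u + 1) N = insert (u + 1) (oddIdx (u + 1 + 1) N) := by
        ext v
        simp only [Finset.mem_insert, mem_oddIdx]
        rw [Nat.odd_iff]
        rw [Nat.even_iff] at hp
        omega
      rw [this, Finset.sum_insert (by simp [mem_oddIdx])]
      linarith [he u hu hp]
    · have : oddIdx (u + 1) N = oddIdx (u + 1 + 1) N := by
        ext v
        simp only [mem_oddIdx]
        rw [Nat.odd_iff] at hp ⊢
        omega
      rw [this]
      exact (ho u hu hp).trans ih

lemma exists_isSplitting {d : ℤ} (hd : 0 < d) (r : ℕ) (n : ℕ →₀ ℕ)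
    (h : d ≤ ∑ v ∈ oddIdx 1 (2 * r - 1), (n v : ℤ)) : ∃ l n' n'', IsSplitting d r n l n' n'' := by
  set f : ℕ → ℤ := fun l => ∑ v ∈ oddIdx (2 * l + 1) (2 * r - 1), (n v : ℤ) with hf
  have hfr : f r < d := by
    have : oddIdx (2 * r + 1) (2 * r - 1) = ∅ := by
      ext v
      simp only [mem_oddIdx, Finset.notMem_empty, iff_false]
      rintro ⟨h1, -⟩
      omega
    simpa [hf, this] using hd
  -- The tail sums `f l` of odd-positioned entries start at or above `d` and end at `0`. The
  -- splitting index is the last `l` before they first drop below `d`, and `n''` is what `f (l + 1)`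
  -- lacks to `d`.
  have hex : ∃ l, f l < d := ⟨r, hfr⟩
  have hlt := Nat.find_spec hex
  obtain ⟨l, hl⟩ : ∃ l, Nat.find hex = l + 1 := by
    refine Nat.exists_eq_succ_of_ne_zero fun h0 => ?_
    rw [h0] at hlt
    exact absurd h (not_le.2 hlt)
  rw [hl] at hlt
  have hge : d ≤ f l := not_lt.1 (Nat.find_min hex (m := l) (by omega))
  have hlr : l + 1 ≤ r := hl ▸ Nat.find_min' hex hfr
  have hs : f l = n (2 * l + 1) + f (l + 1) := by
    have : oddIdx (2 * l + 1) (2 * r - 1) =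
        insert (2 * l + 1) (oddIdx (2 * (l + 1) + 1) (2 * r - 1)) := by
      ext v
      simp only [Finset.mem_insert, mem_oddIdx]
      rw [Nat.odd_iff]
      omega
    simp only [hf]
    rw [this, Finset.sum_insert (by simp [mem_oddIdx])]
  refine ⟨l, n (2 * l + 1) - (d - f (l + 1)).toNat, (d - f (l + 1)).toNat, hlr, by omega,
    by omega, ?_⟩
  have : f (l + 1) = ∑ u ∈ oddIdx (2 * l + 3) (2 * r - 1), (n u : ℤ) := rfl
  rw [← this]
  omega

/-- For `u > 2l` the defining equation of the splitting makes `paramBound` equal to the sum of the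
odd-positioned entries after `u`. -/
lemma le_paramBound {d : ℤ} {r : ℕ} {n : ℕ →₀ ℕ} {l n' n'' : ℕ}
    (hsp : IsSplitting d r n l n' n'') {u : ℕ} (hu : u ≤ 2 * r - 2) {y : ℤ} (h1 : y ≤ d - 1)
    (h2 : y ≤ ∑ v ∈ oddIdx (u + 1) (2 * r - 1), (n v : ℤ)) : y ≤ paramBound d n l n'' u := by
  unfold paramBound
  split_ifs with hul
  · exact h1
  · have hun : oddIdx (2 * l + 3) (2 * r - 1) =
        oddIdx (2 * l + 3) u ∪ oddIdx (u + 1) (2 * r - 1) := by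
      ext v
      simp only [Finset.mem_union, mem_oddIdx]
      rw [Nat.odd_iff]
      omega
    have hdis : Disjoint (oddIdx (2 * l + 3) u) (oddIdx (u + 1) (2 * r - 1)) := by
      rw [Finset.disjoint_left]
      intro v
      simp only [mem_oddIdx]
      omega
    have h3 := hsp.2.2.2
    rw [hun, Finset.sum_union hdis] at h3
    linarith

lemma mem_params_iff {d : ℤ} {r : ℕ} {n : ℕ →₀ ℕ} {st : (ℕ →₀ ℤ) × (ℕ →₀ ℤ)} :
    st ∈ params d r n ↔
      ((st.1.support ⊆ oddIdx 1 (2 * r - 2) ∧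
          ∀ u ∈ oddIdx 1 (2 * r - 2), st.1 u ∈ Finset.Icc 1 (d - 1)) ∧
        (st.2.support ⊆ evenIdx 1 (2 * r - 2) ∧
          ∀ u ∈ evenIdx 1 (2 * r - 2), st.2 u ∈ Finset.Icc 1 (d - 1))) ∧
      ∃ l n' n'' : ℕ, IsSplitting d r n l n' n'' ∧
        (∀ u ∈ oddIdx 1 (2 * r - 2), st.1 u ≤ paramBound d n l n'' u) ∧
        (∀ u ∈ evenIdx 1 (2 * r - 2), st.2 u ≤ paramBound d n l n'' u) := by
  classical
  rw [params, Finset.mem_filter, Finset.mem_product, Finset.mem_finsupp_iff,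
    Finset.mem_finsupp_iff]


/-! ### First and last letters, run lengths -/

lemma eq_of_weight_pos {x : Bool × Bool} (h : 0 < weight x) : x = (true, true) := by
  obtain ⟨x, y⟩ := x
  cases x <;> cases y <;> simp [weight] at h ⊢

lemma Admissible.head? {d x : ℤ} {g : ℕ} {L : PairWord} (hd : 0 < d) (h : Admissible d x g L) :
    L.head? = some (true, true) := by
  obtain ⟨rfl, -, h3, h4⟩ := h
  cases L with
  | nil => simp at h3; omega
  | cons y L =>
    suffices 0 < weight y by rw [eq_of_weight_pos this]; rfl
    cases L with
    | nil => simpa [← h3] using hd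
    | cons z L => simpa using (h4 1 one_pos (by simp)).1

lemma Admissible.getLast? {d x : ℤ} {g : ℕ} {L : PairWord} (hd : 0 < d)
    (h : Admissible d x g L) : L.getLast? = some (true, true) := by
  obtain ⟨rfl, -, h3, h4⟩ := h
  rcases List.eq_nil_or_concat' L with rfl | ⟨M, y, rfl⟩
  · simp at h3; omega
  · suffices 0 < weight y by rw [eq_of_weight_pos this]; simp
    rw [height_append, height_singleton] at h3
    rcases eq_or_ne M [] with rfl | hM
    · simp at h3; omega
    · have := (h4 M.length (List.length_pos_iff.2 hM) (by simp)).2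
      rw [List.take_left] at this
      omega

lemma head?_build {F : ℕ → List Bool} (h : F 0 ≠ []) (m : ℕ) :
    (build F (m + 1)).head? = (F 0).head?.map (Prod.mk true) := by
  induction m with
  | zero => simp [build, block]
  | succ m ih =>
    rw [build, List.head?_append_of_ne_nil, ih]
    intro h0
    rw [h0] at ih
    simp [h] at ih

lemma getLast?_build {F : ℕ → List Bool} {m : ℕ} (h : F m ≠ []) :
    (build F (m + 1)).getLast? = (F m).getLast?.map (Prod.mk (decide (Even m))) := by
  rw [build, List.getLast?_append_of_ne_nil _ (by simpa [block] using h), block,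
    List.getLast?_map]

lemma sum_range_succ_eq_sum_Icc {M : Type*} [AddCommMonoid M] (f : ℕ → M) (N : ℕ) :
    ∑ u ∈ Finset.range N, f (u + 1) = ∑ u ∈ Finset.Icc 1 N, f u := by
  induction N with
  | zero => simp
  | succ N ih => rw [Finset.sum_range_succ, ih, Finset.sum_Icc_succ_top (by omega)]

lemma sum_range_even_eq_sum_oddIdx (f : ℕ → ℤ) (N : ℕ) :
    (∑ u ∈ Finset.range N, if Even u then f (u + 1) else 0) = ∑ u ∈ oddIdx 1 N, f u := by
  rw [oddIdx, Finset.sum_filter, ← sum_range_succ_eq_sum_Icc]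
  exact Finset.sum_congr rfl fun u _ => by simp [Nat.odd_add_one]

lemma sum_oddIdx_add_sum_evenIdx (f : ℕ → ℤ) (lo hi : ℕ) :
    ∑ u ∈ oddIdx lo hi, f u + ∑ u ∈ evenIdx lo hi, f u = ∑ u ∈ Finset.Icc lo hi, f u := by
  rw [oddIdx, evenIdx, ← Finset.sum_filter_add_sum_filter_not (Finset.Icc lo hi) Odd]
  simp only [Nat.not_odd_iff_even]

lemma mem_tuples_iff {g : ℕ} {x : ℤ} {r : ℕ} {n : ℕ →₀ ℕ} :
    n ∈ tuples g x r ↔ (∑ u ∈ Finset.Icc 1 (2 * r - 1), n u = g ∧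
      n.support ⊆ Finset.Icc 1 (2 * r - 1)) ∧ (∀ u ∈ Finset.Icc 1 (2 * r - 1), 1 ≤ n u) ∧
      ∑ u ∈ oddIdx 1 (2 * r - 1), (n u : ℤ) = x := by
  rw [tuples, Finset.mem_filter, Finset.mem_finsuppAntidiag]
  refine and_congr_right fun h => and_congr_right fun _ => and_iff_left_of_imp fun h2 => ?_
  have h3 := sum_oddIdx_add_sum_evenIdx (fun u => (n u : ℤ)) 1 (2 * r - 1)
  have h4 : ∑ u ∈ Finset.Icc 1 (2 * r - 1), (n u : ℤ) = g := by exact_mod_cast h.1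
  linarith

/-! ### Concatenations of blocks with given parameters -/

section Build

variable {d : ℤ} {r : ℕ} {n : ℕ →₀ ℕ} {s t : ℕ →₀ ℤ} {F : ℕ → List Bool}

lemma height_build_of_mem (hF : ∀ u < 2 * r - 1, F u ∈ blockSet d r n s t u) {u : ℕ}
    (hu : u ≤ 2 * r - 1) : height (build F u) = d - deficit d s t u := by
  induction u with
  | zero => simp [build, deficit]
  | succ u ih =>
    rw [height_build_succ, ih (by omega), (mem_blockSet.1 (hF u hu)).2.1, differences]
    split_ifs <;> ring

lemma length_build_of_mem (hF : ∀ u < 2 * r - 1, F u ∈ blockSet d r n s t u) :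
    (build F (2 * r - 1)).length = ∑ u ∈ Finset.Icc 1 (2 * r - 1), n u := by
  rw [length_build, ← sum_range_succ_eq_sum_Icc]
  exact Finset.sum_congr rfl fun u hu => (mem_blockSet.1 (hF u (Finset.mem_range.1 hu))).1

lemma countA_build_of_mem (hF : ∀ u < 2 * r - 1, F u ∈ blockSet d r n s t u) :
    countA (build F (2 * r - 1)) = ∑ u ∈ oddIdx 1 (2 * r - 1), (n u : ℤ) := by
  rw [countA_build, ← sum_range_even_eq_sum_oddIdx]
  exact Finset.sum_congr rfl fun u hu => by
    rw [(mem_blockSet.1 (hF u (Finset.mem_range.1 hu))).1]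

lemma ne_nil_of_mem (hn : ∀ u ∈ Finset.Icc 1 (2 * r - 1), 1 ≤ n u)
    (hF : ∀ u < 2 * r - 1, F u ∈ blockSet d r n s t u) {u : ℕ} (hu : u < 2 * r - 1) :
    F u ≠ [] := by
  have h1 := (mem_blockSet.1 (hF u hu)).1
  have h2 := hn (u + 1) (by simp; omega)
  exact List.length_pos_iff.1 (by omega)

/-- A prefix ends inside one block, on which the height is monotone, so the bounds at the two ends
of the block suffice. The exceptions are the lower end of the first block and the upper end of the
last one. -/
lemma height_take_build_of_mem (hr : 2 ≤ r)
    (hF : ∀ u < 2 * r - 1, F u ∈ blockSet d r n s t u)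
    (hdef : ∀ u, 0 < u → u < 2 * r - 1 → 0 < deficit d s t u ∧ deficit d s t u < d)
    (hend : deficit d s t (2 * r - 1) = 0)
    {k : ℕ} (hk0 : 0 < k) (hk : k < (build F (2 * r - 1)).length) :
    0 < height ((build F (2 * r - 1)).take k) ∧ height ((build F (2 * r - 1)).take k) < d := by
  obtain ⟨u, hu, j, hj, rfl, htake⟩ := exists_take_build F hk
  rw [htake, height_append, height_block, height_build_of_mem hF hu.le]
  obtain ⟨-, hcount, hhead, hlast⟩ := mem_blockSet.1 (hF u hu)
  have hsplit : (F u).count true = ((F u).take j).count true + ((F u).drop j).count true := by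
    rw [← List.count_append, List.take_append_drop]
  rw [differences] at hcount
  split_ifs at hcount ⊢ with hp
  · constructor
    · rcases Nat.eq_zero_or_pos u with rfl | hu0
      -- The height starts at `0`, but the forced difference at the first place has already been
      -- read.
      · have : 0 < ((F 0).take j).count true := by
          rw [List.count_pos_iff]
          have hj0 : 0 < j := by simpa [build] using hk0
          obtain ⟨l, hl⟩ := List.head?_eq_some_iff.1 (hhead rfl)
          rw [hl]
          obtain ⟨j, rfl⟩ := Nat.exists_eq_add_of_le' hj0
          simp
        simp only [deficit, if_true]
        omega
      · have := hdef u hu0 hu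
        omega
    · rcases eq_or_ne (u + 1) (2 * r - 1) with he | he
      -- The height ends at `d`, but the forced difference at the last place is still unread.
      · have : 0 < ((F u).drop j).count true := by
          rw [List.count_pos_iff]
          obtain ⟨l, hl⟩ := List.getLast?_eq_some_iff.1 (hlast he)
          rw [hl] at hj ⊢
          rw [List.drop_append_of_le_length (by simp at hj; omega)]
          simp
        rw [he, hend] at hcount
        omega
      · have := hdef (u + 1) (by omega) (by omega)
        omega
  · rw [Nat.not_even_iff_odd, Nat.odd_iff] at hp
    have h1 := hdef u (by omega) hu
    have h2 := hdef (u + 1) (by omega) (by omega)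
    omega

lemma deficit_eq_left (ht : t.support ⊆ evenIdx 1 (2 * r - 2)) {u : ℕ} (hu : Odd u) :
    deficit d s t u = s u := by
  rw [deficit, if_neg (by rintro rfl; simp at hu), add_eq_left]
  refine Finsupp.notMem_support_iff.1 fun h => ?_
  exact Nat.not_even_iff_odd.2 hu (mem_evenIdx.1 (ht h)).2

lemma deficit_eq_right (hs : s.support ⊆ oddIdx 1 (2 * r - 2)) {u : ℕ} (h0 : 0 < u)
    (hu : Even u) : deficit d s t u = t u := by
  rw [deficit, if_neg h0.ne', add_eq_right]
  refine Finsupp.notMem_support_iff.1 fun h => ?_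
  exact Nat.not_even_iff_odd.2 (mem_oddIdx.1 (hs h)).2 hu

lemma deficit_last (hr : 2 ≤ r) (hs : s.support ⊆ oddIdx 1 (2 * r - 2))
    (ht : t.support ⊆ evenIdx 1 (2 * r - 2)) : deficit d s t (2 * r - 1) = 0 := by
  rw [deficit_eq_left ht ⟨r - 1, by omega⟩]
  refine Finsupp.notMem_support_iff.1 fun h => ?_
  have := (mem_oddIdx.1 (hs h)).1
  omega

/-- Only `a`-runs reduce the deficit, each by at most its length, and the final deficit is `0`. -/
lemma deficit_le_sum (hr : 2 ≤ r) (hs : s.support ⊆ oddIdx 1 (2 * r - 2))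
    (ht : t.support ⊆ evenIdx 1 (2 * r - 2))
    (hF : ∀ u < 2 * r - 1, F u ∈ blockSet d r n s t u) {u : ℕ} (hu : u ≤ 2 * r - 1) :
    deficit d s t u ≤ ∑ v ∈ oddIdx (u + 1) (2 * r - 1), (n v : ℤ) := by
  refine le_sum_oddIdx (deficit_last hr hs ht) (fun v hv hp => ?_) (fun v hv hp => ?_) hu
  · obtain ⟨h1, h2, -⟩ := mem_blockSet.1 (hF v hv)
    rw [differences, if_pos hp] at h2
    have := List.count_le_length (a := true) (l := F v)
    omega
  · obtain ⟨h1, h2, -⟩ := mem_blockSet.1 (hF v hv)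
    rw [differences, if_neg (Nat.not_even_iff_odd.2 hp)] at h2
    omega

lemma mem_params_of_mem (hd : 0 < d) (hr : 2 ≤ r) (hs : s.support ⊆ oddIdx 1 (2 * r - 2))
    (ht : t.support ⊆ evenIdx 1 (2 * r - 2))
    (hF : ∀ u < 2 * r - 1, F u ∈ blockSet d r n s t u)
    (hdef : ∀ u, 0 < u → u < 2 * r - 1 → 0 < deficit d s t u ∧ deficit d s t u < d) :
    (s, t) ∈ params d r n := by
  have hso : ∀ u ∈ oddIdx 1 (2 * r - 2), s u = deficit d s t u ∧ 0 < u ∧ u < 2 * r - 1 :=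
    fun u hu => ⟨(deficit_eq_left ht (mem_oddIdx.1 hu).2).symm, by
      have := (mem_oddIdx.1 hu).1; omega⟩
  have hte : ∀ u ∈ evenIdx 1 (2 * r - 2), t u = deficit d s t u ∧ 0 < u ∧ u < 2 * r - 1 :=
    fun u hu => ⟨(deficit_eq_right hs (mem_evenIdx.1 hu).1.1 (mem_evenIdx.1 hu).2).symm, by
      have := (mem_evenIdx.1 hu).1; omega⟩
  have h0 := deficit_le_sum hr hs ht hF (Nat.zero_le (2 * r - 1))
  obtain ⟨l, n', n'', hsp⟩ := exists_isSplitting hd r n (by simpa [deficit] using h0)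
  have hle : ∀ u, 0 < u → u < 2 * r - 1 → deficit d s t u ≤ paramBound d n l n'' u :=
    fun u h1 h2 => le_paramBound hsp (by omega) (by have := hdef u h1 h2; omega)
      (deficit_le_sum hr hs ht hF h2.le)
  rw [mem_params_iff]
  refine ⟨⟨⟨hs, fun u hu => ?_⟩, ht, fun u hu => ?_⟩, l, n', n'', hsp, fun u hu => ?_,
    fun u hu => ?_⟩
  · obtain ⟨h1, h2, h3⟩ := hso u hu
    have := hdef u h2 h3
    rw [h1, Finset.mem_Icc]
    omega
  · obtain ⟨h1, h2, h3⟩ := hte u hu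
    have := hdef u h2 h3
    change t u ∈ _
    rw [h1, Finset.mem_Icc]
    omega
  · obtain ⟨h1, h2, h3⟩ := hso u hu
    exact h1 ▸ hle u h2 h3
  · obtain ⟨h1, h2, h3⟩ := hte u hu
    exact h1 ▸ hle u h2 h3

lemma deficit_bounds_of_mem_params (hst : (s, t) ∈ params d r n) {u : ℕ} (h0 : 0 < u)
    (hu : u < 2 * r - 1) : 0 < deficit d s t u ∧ deficit d s t u < d := by
  obtain ⟨⟨⟨hs, hs'⟩, ht, ht'⟩, -⟩ := mem_params_iff.1 hst
  simp only [Finset.mem_Icc] at hs' ht'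
  rcases Nat.even_or_odd u with hp | hp
  · rw [deficit_eq_right hs h0 hp]
    have := ht' u (mem_evenIdx.2 ⟨⟨h0, by omega⟩, hp⟩)
    omega
  · rw [deficit_eq_left ht hp]
    have := hs' u (mem_oddIdx.2 ⟨⟨h0, by omega⟩, hp⟩)
    omega

end Build

/-! ### Admissible pairs correspond to the data `r`, `n`, `(s, t)` and a choice of blocks -/

lemma admissible_of_mem {d x : ℤ} {g r : ℕ} {n : ℕ →₀ ℕ} {st : (ℕ →₀ ℤ) × (ℕ →₀ ℤ)}
    (hr : 2 ≤ r) (hn : n ∈ tuples g x r) (hst : st ∈ params d r n) {L : PairWord}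
    (hL : L ∈ concatenations (blockSet d r n st.1 st.2) (2 * r - 1)) : Admissible d x g L := by
  obtain ⟨F, hF, rfl⟩ := mem_concatenations.1 hL
  obtain ⟨⟨hsum, -⟩, -, hodd⟩ := mem_tuples_iff.1 hn
  obtain ⟨⟨⟨hs, -⟩, ht, -⟩, -⟩ := mem_params_iff.1 hst
  have hend := deficit_last (d := d) hr hs ht
  have hlen := (length_build_of_mem hF).trans hsum
  refine ⟨hlen, (countA_build_of_mem hF).trans hodd, ?_, fun k hk0 hk => ?_⟩
  · rw [height_build_of_mem hF le_rfl, hend, sub_zero]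
  · exact height_take_build_of_mem hr hF (fun u => deficit_bounds_of_mem_params hst) hend hk0
      (by omega)

lemma exists_mem_of_admissible {d x : ℤ} {g : ℕ} (hd : 0 < d) (hx : x ≠ g) {L : PairWord}
    (hL : Admissible d x g L) : ∃ r, 2 ≤ r ∧ 2 * r - 1 ≤ g ∧ ∃ n ∈ tuples g x r,
      ∃ st ∈ params d r n, L ∈ concatenations (blockSet d r n st.1 st.2) (2 * r - 1) := by
  have hhead := hL.head? hd
  have hlast := hL.getLast? hd
  obtain ⟨hlen, hcA, hht, hpre⟩ := hL
  obtain ⟨m, F, hne, rfl⟩ := exists_build L (by rw [hhead]; rfl)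
  rw [head?_build (hne 0 (by omega))] at hhead
  rw [getLast?_build (hne m (by omega))] at hlast
  simp only [Option.map_eq_some_iff, Prod.mk.injEq, true_and, exists_eq_right,
    decide_eq_true_eq] at hhead hlast
  obtain ⟨_, hlast, hm, rfl⟩ := hlast
  obtain ⟨q, rfl⟩ := hm
  -- A single run would make the first word `a^g`, hence `x = g`.
  have hq : q ≠ 0 := by
    rintro rfl
    apply hx
    rw [← hcA, ← hlen, countA_build, length_build]
    simp
  set r := q + 1 with hr
  have e : q + q + 1 = 2 * r - 1 := by omega
  rw [e] at hne hlen hcA hht hpre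
  set n : ℕ →₀ ℕ := Finsupp.onFinset (Finset.Icc 1 (2 * r - 1))
    (fun u => if u ∈ Finset.Icc 1 (2 * r - 1) then (F (u - 1)).length else 0)
    (fun u hu => by by_contra h; simp [h] at hu) with hn
  -- The parameters are the deficits at the ends of runs, distributed by parity.
  set s : ℕ →₀ ℤ := Finsupp.onFinset (oddIdx 1 (2 * r - 2))
    (fun u => if u ∈ oddIdx 1 (2 * r - 2) then d - height (build F u) else 0)
    (fun u hu => by by_contra h; simp [h] at hu) with hs
  set t : ℕ →₀ ℤ := Finsupp.onFinset (evenIdx 1 (2 * r - 2))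
    (fun u => if u ∈ evenIdx 1 (2 * r - 2) then d - height (build F u) else 0)
    (fun u hu => by by_contra h; simp [h] at hu) with ht
  have hss : s.support ⊆ oddIdx 1 (2 * r - 2) := Finsupp.support_onFinset_subset
  have hts : t.support ⊆ evenIdx 1 (2 * r - 2) := Finsupp.support_onFinset_subset
  have hnF : ∀ u < 2 * r - 1, n (u + 1) = (F u).length := by
    intro u hu
    rw [hn, Finsupp.onFinset_apply, if_pos (by simp; omega), Nat.add_sub_cancel]
  have hdefic : ∀ u ≤ 2 * r - 1, deficit d s t u = d - height (build F u) := by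
    intro u hu
    rcases Nat.eq_zero_or_pos u with rfl | h0
    · simp [deficit, build]
    rcases hu.lt_or_eq with hu | rfl
    · rcases Nat.even_or_odd u with hp | hp
      · rw [deficit_eq_right hss h0 hp, ht, Finsupp.onFinset_apply,
          if_pos (mem_evenIdx.2 ⟨⟨h0, by omega⟩, hp⟩)]
      · rw [deficit_eq_left hts hp, hs, Finsupp.onFinset_apply,
          if_pos (mem_oddIdx.2 ⟨⟨h0, by omega⟩, hp⟩)]
    · rw [deficit_last (by omega) hss hts, hht, sub_self]
  have hlenF : ∀ u < 2 * r - 1, 0 < (F u).length := fun u hu => List.length_pos_iff.2 (hne u hu)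
  have hF : ∀ u < 2 * r - 1, F u ∈ blockSet d r n s t u := by
    intro u hu
    rw [mem_blockSet]
    refine ⟨(hnF u hu).symm, ?_, ?_, fun hu' => ?_⟩
    · rw [differences, hdefic u hu.le, hdefic (u + 1) hu, height_build_succ]
      split_ifs <;> ring
    · rintro rfl
      exact hhead
    · obtain rfl : u = q + q := by omega
      exact hlast
  -- Interior ends of runs occur at times strictly between `0` and `g`, where the strict height
  -- bounds apply; for `u = 2r-2` this also yields `2r-1 ≤ g`.
  have hlen' : ∀ u < 2 * r - 1, u ≤ (build F u).length ∧
      (build F u).length < (build F (2 * r - 1)).length := by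
    intro u hu
    rw [length_build, length_build]
    constructor
    · calc u = ∑ v ∈ Finset.range u, 1 := by simp
        _ ≤ _ := Finset.sum_le_sum fun v hv => hlenF v (by have := Finset.mem_range.1 hv; omega)
    · refine Finset.sum_lt_sum_of_subset (i := u) ?_ (by simpa using hu) (by simp) (hlenF u hu)
        (fun _ _ _ => Nat.zero_le _)
      exact Finset.range_mono hu.le
  have htake : ∀ u ≤ 2 * r - 1, (build F (2 * r - 1)).take (build F u).length = build F u := by
    intro u hu
    induction hu using Nat.decreasingInduction with
    | self => simp
    | of_succ u hu ih =>
      have h1 : (build F (u + 1)).take (build F u).length = build F u := by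
        rw [build, List.take_left]
      rw [← ih, List.take_take, min_eq_left] at h1
      · exact h1
      · rw [build, List.length_append]
        omega
  have hdef : ∀ u, 0 < u → u < 2 * r - 1 → 0 < deficit d s t u ∧ deficit d s t u < d := by
    intro u h0 hu
    have h1 := hlen' u hu
    have h2 := hpre (build F u).length (by omega) (by omega)
    rw [htake u hu.le] at h2
    rw [hdefic u hu.le]
    omega
  refine ⟨r, by omega, ?_, n, ?_, (s, t), mem_params_of_mem hd (by omega) hss hts hF hdef,
    mem_concatenations.2 ⟨F, hF, by rw [e]⟩⟩
  · have := hlen' (2 * r - 2) (by omega)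
    omega
  · rw [mem_tuples_iff]
    refine ⟨⟨(length_build_of_mem hF).symm.trans hlen, Finsupp.support_onFinset_subset⟩,
      fun u hu => ?_, (countA_build_of_mem hF).symm.trans hcA⟩
    rw [Finset.mem_Icc] at hu
    obtain ⟨u, rfl⟩ := Nat.exists_eq_add_of_le' hu.1
    rw [hnF u (by omega)]
    exact hlenF u (by omega)

/-- The runs determine `r` and `n`, and the heights at their ends determine `s` and `t`. -/
lemma data_unique {d x : ℤ} {g r r' : ℕ} {n n' : ℕ →₀ ℕ} {st st' : (ℕ →₀ ℤ) × (ℕ →₀ ℤ)}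
    (hr : 2 ≤ r) (hr' : 2 ≤ r') (hn : n ∈ tuples g x r) (hn' : n' ∈ tuples g x r')
    (hst : st ∈ params d r n) (hst' : st' ∈ params d r' n') {L : PairWord}
    (hL : L ∈ concatenations (blockSet d r n st.1 st.2) (2 * r - 1))
    (hL' : L ∈ concatenations (blockSet d r' n' st'.1 st'.2) (2 * r' - 1)) :
    r = r' ∧ n = n' ∧ st = st' := by
  obtain ⟨F, hF, rfl⟩ := mem_concatenations.1 hL
  obtain ⟨G, hG, hGF⟩ := mem_concatenations.1 hL'
  obtain ⟨⟨-, hsupp⟩, hpos, -⟩ := mem_tuples_iff.1 hn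
  obtain ⟨⟨-, hsupp'⟩, hpos', -⟩ := mem_tuples_iff.1 hn'
  obtain ⟨⟨⟨hs, -⟩, ht, -⟩, -⟩ := mem_params_iff.1 hst
  obtain ⟨⟨⟨hs', -⟩, ht', -⟩, -⟩ := mem_params_iff.1 hst'
  obtain ⟨he, hFG⟩ := build_inj (fun u => ne_nil_of_mem hpos hF)
    (fun u => ne_nil_of_mem hpos' hG) hGF.symm
  obtain rfl : r = r' := by omega
  have hdefic : ∀ u ≤ 2 * r - 1, deficit d st.1 st.2 u = deficit d st'.1 st'.2 u := by
    intro u hu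
    have h1 := height_build_of_mem hF hu
    rw [build_congr fun v hv => hFG v (by omega), height_build_of_mem hG hu] at h1
    omega
  refine ⟨rfl, ?_, Prod.ext ?_ ?_⟩
  · ext u
    by_cases hu : u ∈ Finset.Icc 1 (2 * r - 1)
    · rw [Finset.mem_Icc] at hu
      obtain ⟨u, rfl⟩ := Nat.exists_eq_add_of_le' hu.1
      rw [← (mem_blockSet.1 (hF u (by omega))).1, ← (mem_blockSet.1 (hG u (by omega))).1,
        hFG u (by omega)]
    · rw [Finsupp.notMem_support_iff.1 fun h => hu (hsupp h),
        Finsupp.notMem_support_iff.1 fun h => hu (hsupp' h)]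
  · ext u
    by_cases hu : u ∈ oddIdx 1 (2 * r - 2)
    · have hu' := mem_oddIdx.1 hu
      rw [← deficit_eq_left (d := d) ht hu'.2, ← deficit_eq_left (d := d) ht' hu'.2,
        hdefic u (by omega)]
    · rw [Finsupp.notMem_support_iff.1 fun h => hu (hs h),
        Finsupp.notMem_support_iff.1 fun h => hu (hs' h)]
  · ext u
    by_cases hu : u ∈ evenIdx 1 (2 * r - 2)
    · have hu' := mem_evenIdx.1 hu
      rw [← deficit_eq_right (d := d) hs hu'.1.1 hu'.2,
        ← deficit_eq_right (d := d) hs' hu'.1.1 hu'.2, hdefic u (by omega)]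
    · rw [Finsupp.notMem_support_iff.1 fun h => hu (ht h),
        Finsupp.notMem_support_iff.1 fun h => hu (ht' h)]

lemma card_concatenations_blockSet {d x : ℤ} {g r : ℕ} {n : ℕ →₀ ℕ}
    {st : (ℕ →₀ ℤ) × (ℕ →₀ ℤ)} (hr : 2 ≤ r) (hn : n ∈ tuples g x r) (hst : st ∈ params d r n) :
    (concatenations (blockSet d r n st.1 st.2) (2 * r - 1)).card =
      summand d r n st.1 st.2 := by
  obtain ⟨⟨⟨hs, -⟩, ht, -⟩, -⟩ := mem_params_iff.1 hst
  rw [card_concatenations _ (fun u => n (u + 1)) _ fun u _ l hl => (mem_blockSet.1 hl).1,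
    prod_card_blockSet d hr n _ _ (mem_tuples_iff.1 hn).2.1 hs ht]

lemma ncard_admissible {d x : ℤ} {g : ℕ} (hd : 0 < d) (hx : x ≠ g) :
    {L | Admissible d x g L}.Finite ∧ {L | Admissible d x g L}.ncard =
      ∑ r ∈ Finset.Icc 2 ((g + 1) / 2), ∑ n ∈ tuples g x r, ∑ st ∈ params d r n,
        summand d r n st.1 st.2 := by
  classical
  set I : Finset (Σ _ : ℕ, Σ _ : ℕ →₀ ℕ, (ℕ →₀ ℤ) × (ℕ →₀ ℤ)) :=
    (Finset.Icc 2 ((g + 1) / 2)).sigma fun r => (tuples g x r).sigma fun n => params d r n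
    with hI
  set f : (Σ _ : ℕ, Σ _ : ℕ →₀ ℕ, (ℕ →₀ ℤ) × (ℕ →₀ ℤ)) → Finset PairWord := fun i =>
    concatenations (blockSet d i.1 i.2.1 i.2.2.1 i.2.2.2) (2 * i.1 - 1) with hf
  have hmem : ∀ i ∈ I, 2 ≤ i.1 ∧ i.2.1 ∈ tuples g x i.1 ∧ i.2.2 ∈ params d i.1 i.2.1 := by
    intro i hi
    simp only [hI, Finset.mem_sigma, Finset.mem_Icc] at hi
    exact ⟨hi.1.1, hi.2⟩
  have hS : {L | Admissible d x g L} = ((I.biUnion f : Finset PairWord) : Set PairWord) := by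
    ext L
    simp only [Set.mem_ofPred_eq, Finset.mem_coe, Finset.mem_biUnion]
    constructor
    · intro hL
      obtain ⟨r, hr, hrg, n, hn, st, hst, h⟩ := exists_mem_of_admissible hd hx hL
      refine ⟨⟨r, n, st⟩, ?_, h⟩
      simp only [hI, Finset.mem_sigma, Finset.mem_Icc]
      exact ⟨⟨hr, by omega⟩, hn, hst⟩
    · rintro ⟨i, hi, h⟩
      obtain ⟨h1, h2, h3⟩ := hmem i hi
      exact admissible_of_mem h1 h2 h3 h
  refine ⟨hS ▸ Finset.finite_toSet _, ?_⟩
  rw [hS, Set.ncard_coe_finset, Finset.card_biUnion, Finset.sum_sigma]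
  · refine Finset.sum_congr rfl fun r hr => ?_
    rw [Finset.sum_sigma]
    exact Finset.sum_congr rfl fun n hn => Finset.sum_congr rfl fun st hst =>
      card_concatenations_blockSet (Finset.mem_Icc.1 hr).1 hn hst
  · rintro ⟨r, n, st⟩ hi ⟨r', n', st'⟩ hi' hne
    obtain ⟨h1, h2, h3⟩ := hmem _ hi
    obtain ⟨h1', h2', h3'⟩ := hmem _ hi'
    refine Finset.disjoint_left.2 fun L hL hL' => hne ?_
    obtain ⟨rfl, rfl, rfl⟩ := data_unique h1 h1' h2 h2' h3 h3' hL hL'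
    rfl

end AbelianBorder

/-! ### The main theorem -/

theorem proposition2p14 (n i j : ℕ) (l₁ l₂ k : ℤ) (A₁ A₂ Aₖ : ℤ × ℤ)
    (hA₁ : A₁ = (l₁, (n : ℤ) - i - l₁))
    (hA₂ : A₂ = (l₂, (n : ℤ) - i - l₂))
    (hAₖ : Aₖ = (k, (j : ℤ) - k))
    (hγ : n + 3 ≤ i + j) (hl : 2 ≤ l₁ - l₂) (hY : Aₖ.2 ≠ A₂.2) :
    (AbelianBorder.pathTriples A₂ A₁ Aₖ).Finite ∧
    (AbelianBorder.pathTriples A₂ A₁ Aₖ).ncard =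
      ∑ r ∈ Finset.Icc 2 ((i + j - n + 1) / 2),
        ∑ ν ∈ AbelianBorder.tuples (i + j - n) (k - l₂) r,
          ∑ st ∈ AbelianBorder.params (l₁ - l₂) r ν,
            AbelianBorder.summand (l₁ - l₂) r ν st.1 st.2 := by
  subst hA₂
  have hd : 0 < l₁ - l₂ := by omega
  obtain rfl : A₁ = (l₂ + (l₁ - l₂), (n : ℤ) - i - l₂ - (l₁ - l₂)) := by
    rw [hA₁]; ext <;> simp
  -- The truncated subtraction `i + j - n` is genuine because `n + 3 ≤ i + j`.
  have hK : Aₖ = (l₂ + (k - l₂), (n : ℤ) - i - l₂ + ((i + j - n : ℕ) - (k - l₂))) := by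
    rw [hAₖ]; ext <;> (simp; try omega)
  -- `A₂` and `Aₖ` have equal second coordinates exactly when `k - l₂ = g`.
  have hx : k - l₂ ≠ (i + j - n : ℕ) := by
    rw [hAₖ] at hY
    simp only at hY
    omega
  subst hK
  have key := AbelianBorder.ncard_admissible hd hx
  refine ⟨?_, (AbelianBorder.ncard_pathTriples hd _ (l₂, (n : ℤ) - i - l₂)).trans key.2⟩
  exact AbelianBorder.pathTriples_eq_image hd _ (l₂, (n : ℤ) - i - l₂) ▸ key.1.image _
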